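/- Let $M$ and $\widehat M$ be connected, oriented, smooth Riemannian manifolds of the same dimension $n$, let $\tau>0$, and let $x\colon[0,\tau]\to M$ and $\widehat x\colon[0,\tau]\to\widehat M$ be absolutely continuous curves. Write $\frac{D}{dt}$ for the Levi-Civita covariant derivative along a curve; a vector field $Z$ along a curve is parallel if it is absolutely continuous and $\frac{D}{dt}Z=0$ almost everywhere. A *rolling* of $M$ on $\widehat M$ along $x$ and $\widehat x$ is an absolutely continuous family of orientation-preserving linear isometries $q(t)\colon T_{x(t)}M\to T_{\widehat x(t)}\widehat M$, $t\in[0,\tau]$, such that (I) (no slip) $\dot{\widehat x}(t)=q(t)\dot x(t)$ for almost every $t$; (II) (no twist) for every absolutely continuous vector field $Z(t)$ along $x(t)$, $q(t)\frac{D}{dt}Z(t)=\frac{D}{dt}\big(q(t)Z(t)\big)$ for almost every $t$. An *anti-development* of $x$ is an absolutely continuous curve $y\colon[0,\tau]\to\mathbb R^n$ with $y(0)=0$ for which there are positively oriented orthonormal frames $f(t)\colon\mathbb R^n\to T_{x(t)}M$, $t\in[0,\tau]$ (orientation-preserving linear isometries), such that each $f_j(t)=f(t)e_j$ is parallel along $x$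 and $f(t)\dot y(t)=\dot x(t)$ for almost every $t$. Anti-developments of $\widehat x$ are defined in the same way with $\widehat M$ in place of $M$. Let $y$ be an anti-development of $x$ and $\widehat y$ an anti-development of $\widehat x$. Then a rolling of $M$ on $\widehat M$ along $x$ and $\widehat x$ exists if and only if a rolling of $\mathbb R^n$ (with its standard Euclidean metric and orientation) on itself along $y$ and $\widehat y$ exists. -/

import Mathlib

open scoped Manifold ContDiff
open Set MeasureTheory Bundle

noncomputable section

namespace Rolling

/-- Model space `ℝⁿ` with its standard Euclidean structure. -/
abbrev RSpace (n : ℕ) : Type := EuclideanSpace ℝ (Fin n)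

/-- Tangent space at `p` of a manifold modelled on `ℝⁿ`. -/
abbrev TSpace (n : ℕ) {M : Type*} [TopologicalSpace M] [ChartedSpace (RSpace n) M] (p : M) : Type :=
  TangentSpace (𝓡 n) p

/-! ### Coordinates -/

section Coordinates

variable {n : ℕ} {M : Type*} [TopologicalSpace M] [ChartedSpace (RSpace n) M]
  [IsManifold (𝓡 n) ∞ M]

/-- Coordinates, in the chart `φ_p` around `p`, of a tangent vector `v` at `z`: this is
`d φ_p (v)` (for `z` in the domain of the chart). -/
def toCoord (n : ℕ) {M : Type*} [TopologicalSpace M] [ChartedSpace (RSpace n) M]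
    [IsManifold (𝓡 n) ∞ M] (p z : M) : TSpace n z →L[ℝ] RSpace n :=
  (trivializationAt (RSpace n) (TangentSpace (𝓡 n) : M → Type _) p).continuousLinearMapAt ℝ z

/-- Tangent vector at `z` with given coordinates in the chart `φ_p` around `p`: this is
`(d φ_p)⁻¹` (for `z` in the domain of the chart). The images of the standard basis vectors are the
coordinate vector fields `∂₁, …, ∂ₙ` at `z`. -/
def ofCoord (n : ℕ) {M : Type*} [TopologicalSpace M] [ChartedSpace (RSpace n) M]
    [IsManifold (𝓡 n) ∞ M] (p z : M) : RSpace n →L[ℝ] TSpace n z :=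
  (trivializationAt (RSpace n) (TangentSpace (𝓡 n) : M → Type _) p).symmL ℝ z

/-- An absolutely continuous curve `x : [0, τ] → M`: it is continuous, and every piece of it that
lies in the domain of a chart is absolutely continuous in that chart. Values of `x` outside
`[0, τ]` play no role. -/
structure ACCurve (n : ℕ) {M : Type*} [TopologicalSpace M] [ChartedSpace (RSpace n) M]
    (τ : ℝ) (x : ℝ → M) : Prop where
  continuousOn : ContinuousOn x (Icc 0 τ)
  inChart : ∀ (p : M) (a b : ℝ), 0 ≤ a → a ≤ b → b ≤ τ →
    MapsTo x (Icc a b) (chartAt (RSpace n) p).source →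
    AbsolutelyContinuousOnInterval (fun t => extChartAt (𝓡 n) p (x t)) a b

/-- An absolutely continuous vector field `Z` along a curve `x : [0, τ] → M`: in every chart its
coordinates are absolutely continuous. -/
def ACField (τ : ℝ) (x : ℝ → M) (Z : ∀ t, TSpace n (x t)) : Prop :=
  ∀ (p : M) (a b : ℝ), 0 ≤ a → a ≤ b → b ≤ τ →
    MapsTo x (Icc a b) (chartAt (RSpace n) p).source →
    AbsolutelyContinuousOnInterval (fun t => toCoord n p (x t) (Z t)) a b

/-- The velocity `ẋ(t) ∈ T_{x(t)} M`. -/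
def velocity (n : ℕ) {M : Type*} [TopologicalSpace M] [ChartedSpace (RSpace n) M]
    (x : ℝ → M) (t : ℝ) : TSpace n (x t) :=
  mfderiv 𝓘(ℝ, ℝ) (𝓡 n) x t (1 : ℝ)

end Coordinates

/-! ### The Levi-Civita connection along a curve -/

section LeviCivita

variable {n : ℕ} {M : Type*} [TopologicalSpace M] [ChartedSpace (RSpace n) M]
  [IsManifold (𝓡 n) ∞ M] [RiemannianBundle (fun z : M => TangentSpace (𝓡 n) z)]

/-- The matrix `g_{ij}(u) = ⟨∂ᵢ, ∂ⱼ⟩` of the Riemannian metric in the chart around `p`, as a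
function of the coordinates `u`. -/
def metricMatrix (p : M) (u : RSpace n) : Matrix (Fin n) (Fin n) ℝ :=
  Matrix.of fun i j =>
    inner ℝ
      (ofCoord n p ((extChartAt (𝓡 n) p).symm u) (EuclideanSpace.single i 1))
      (ofCoord n p ((extChartAt (𝓡 n) p).symm u) (EuclideanSpace.single j 1))

/-- The partial derivative `∂ₗ g_{ij}(u)` in the chart around `p`. -/
def metricPartial (p : M) (u : RSpace n) (l i j : Fin n) : ℝ :=
  fderiv ℝ (fun w : RSpace n => metricMatrix p w i j) u (EuclideanSpace.single l 1)

/-- The Christoffel symbols of the Levi-Civita connection in the chart around `p`,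
`Γᵏᵢⱼ = ½ ∑ₗ gᵏˡ (∂ᵢ g_{jl} + ∂ⱼ g_{il} - ∂ₗ g_{ij})`. -/
def christoffel (p : M) (u : RSpace n) (k i j : Fin n) : ℝ :=
  (1 / 2 : ℝ) * ∑ l, (metricMatrix p u)⁻¹ k l *
    (metricPartial p u i j l + metricPartial p u j i l - metricPartial p u l i j)

/-- The Levi-Civita covariant derivative at time `t` of a vector field `Z` along `x`, computed in
the chart around `p` (whose domain should contain `x t`):
`D Z / dt = ∑ₖ (d Zᵏ / dt + ∑ᵢⱼ Γᵏᵢⱼ (d xⁱ / dt) Zʲ) ∂ₖ`. -/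
def covDerivInChart (p : M) (x : ℝ → M) (Z : ∀ t, TSpace n (x t)) (t : ℝ) : TSpace n (x t) :=
  ofCoord n p (x t) (WithLp.toLp 2 fun k =>
    deriv (fun s => toCoord n p (x s) (Z s) k) t +
      ∑ i, ∑ j, christoffel p (extChartAt (𝓡 n) p (x t)) k i j *
        deriv (fun s => extChartAt (𝓡 n) p (x s) i) t * toCoord n p (x t) (Z t) j)

/-- The Levi-Civita covariant derivative `D Z / dt` along `x`. As the value of the coordinate
expression does not depend on the chart, it is evaluated in the preferred chart around `x t`. -/
def covDeriv (x : ℝ → M) (Z : ∀ t, TSpace n (x t)) (t : ℝ) : TSpace n (x t) :=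
  covDerivInChart (x t) x Z t

/-- `Z` is a parallel vector field along the curve `x : [0, τ] → M`. -/
structure IsParallel (τ : ℝ) (x : ℝ → M) (Z : ∀ t, TSpace n (x t)) : Prop where
  ac : ACField τ x Z
  covDeriv_eq_zero : ∀ᵐ t ∂(volume : Measure ℝ), t ∈ Ioo 0 τ → covDeriv x Z t = 0

end LeviCivita

/-! ### Orientations -/

/-- An orientation of a manifold `M` modelled on `ℝⁿ`: an orientation of every tangent space, which
is locally constant when read in charts. -/
structure ManifoldOrientation (n : ℕ) (M : Type*) [TopologicalSpace M]
    [ChartedSpace (RSpace n) M] [IsManifold (𝓡 n) ∞ M] where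
  /-- the orientation of the tangent space at a point -/
  orient : ∀ z : M, Orientation ℝ (TSpace n z) (Fin n)
  locallyConstant : ∀ p : M, ∃ o₀ : Orientation ℝ (RSpace n) (Fin n), ∀ᶠ z in nhds p,
    ∀ hz : z ∈ (trivializationAt (RSpace n) (TangentSpace (𝓡 n) : M → Type _) p).baseSet,
      Orientation.map (Fin n)
        ((trivializationAt (RSpace n) (TangentSpace (𝓡 n) : M → Type _)
          p).continuousLinearEquivAt ℝ z hz).toLinearEquiv (orient z) = o₀

/-- The standard orientation of the vector space `ℝⁿ`. -/
def stdOrientation (n : ℕ) : Orientation ℝ (RSpace n) (Fin n) :=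
  (EuclideanSpace.basisFun (Fin n) ℝ).toBasis.orientation

/-- The standard orientation of `ℝⁿ` as a manifold. -/
def euclideanOrientation (n : ℕ) : ManifoldOrientation n (RSpace n) where
  orient _ := stdOrientation n
  locallyConstant p := by
    refine ⟨stdOrientation n, Filter.Eventually.of_forall fun z hz => ?_⟩
    have h : ((trivializationAt (RSpace n) (TangentSpace (𝓡 n) : RSpace n → Type _)
        p).continuousLinearEquivAt ℝ z hz).toLinearEquiv = LinearEquiv.refl ℝ (RSpace n) := by
      ext1 v
      have h1 := TangentBundle.continuousLinearMapAt_model_space (𝕜 := ℝ) (F := RSpace n) p z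
      have h2 := congrArg (fun A : RSpace n →L[ℝ] RSpace n => A v) h1
      exact (congrFun (Trivialization.coe_continuousLinearEquivAt_eq (R := ℝ)
        (trivializationAt (RSpace n) (TangentSpace (𝓡 n) : RSpace n → Type _) p) hz) v).trans h2
    rw [h]
    exact congrFun (congrArg _ (Orientation.map_refl (R := ℝ) (M := RSpace n) (ι := Fin n))) _

/-! ### Rollings and anti-developments -/

section Rolling

variable {n : ℕ} {M : Type*} [TopologicalSpace M] [ChartedSpace (RSpace n) M]
  [IsManifold (𝓡 n) ∞ M] [RiemannianBundle (fun z : M => TangentSpace (𝓡 n) z)]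
  {M' : Type*} [TopologicalSpace M'] [ChartedSpace (RSpace n) M']
  [IsManifold (𝓡 n) ∞ M'] [RiemannianBundle (fun z : M' => TangentSpace (𝓡 n) z)]

/-- A rolling (without slipping or twisting) of `M` on `M'` along the curves `x : [0, τ] → M` and
`x' : [0, τ] → M'`. A curve in the configuration space
`Q = {A ∈ SO(T_z M, T_z' M') : z ∈ M, z' ∈ M'}` with projections `x` and `x'` is a family of
orientation preserving linear isometries `q t : T_{x t} M → T_{x' t} M'`, `t ∈ [0, τ]`;
values outside `[0, τ]` play no role. -/
structure IsRolling (o : ManifoldOrientation n M) (o' : ManifoldOrientation n M') (τ : ℝ)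
    (x : ℝ → M) (x' : ℝ → M') (q : ∀ t, TSpace n (x t) ≃ₗᵢ[ℝ] TSpace n (x' t)) : Prop where
  /-- `q t` preserves the orientations -/
  oriented : ∀ t ∈ Icc 0 τ, Orientation.map (Fin n) (q t).toLinearEquiv (o.orient (x t)) = o'.orient (x' t)
  /-- the curve `q` in `Q` is absolutely continuous: so are its projections to `M` and `M'`, and so
  is, in charts of `M` and `M'`, the matrix of `q t` -/
  ac_fst : ACCurve n τ x
  ac_snd : ACCurve n τ x'
  ac : ∀ (p : M) (p' : M') (a b : ℝ), 0 ≤ a → a ≤ b → b ≤ τ →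
    MapsTo x (Icc a b) (chartAt (RSpace n) p).source →
    MapsTo x' (Icc a b) (chartAt (RSpace n) p').source →
    AbsolutelyContinuousOnInterval
      (fun t => toCoord n p' (x' t) ∘L ((q t).toContinuousLinearEquiv :
        TSpace n (x t) →L[ℝ] TSpace n (x' t)) ∘L ofCoord n p (x t)) a b
  no_slip : ∀ᵐ t ∂(volume : Measure ℝ), t ∈ Ioo 0 τ → velocity n x' t = q t (velocity n x t)
  no_twist : ∀ Z : ∀ t, TSpace n (x t), ACField τ x Z →
    ∀ᵐ t ∂(volume : Measure ℝ), t ∈ Ioo 0 τ →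
      q t (covDeriv x Z t) = covDeriv x' (fun s => q s (Z s)) t

/-- A horizontal curve `f : [0, τ] → F(M)` over `x` in the bundle of positively oriented
orthonormal frames: every `f t : ℝⁿ → T_{x t} M` is an orientation preserving linear isometry, and
the vector fields `f_j = f e_j` along `x` are parallel. -/
structure IsHorizontal (o : ManifoldOrientation n M) (τ : ℝ) (x : ℝ → M)
    (f : ∀ t, RSpace n ≃ₗᵢ[ℝ] TSpace n (x t)) : Prop where
  oriented : ∀ t ∈ Icc 0 τ,
    Orientation.map (Fin n) (f t).toLinearEquiv (stdOrientation n) = o.orient (x t)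
  parallel : ∀ j : Fin n, IsParallel τ x (fun t => f t (EuclideanSpace.single j 1))

/-- `y : [0, τ] → ℝⁿ` is an anti-development of `x : [0, τ] → M`. -/
structure IsAntiDevelopment (o : ManifoldOrientation n M) (τ : ℝ) (x : ℝ → M)
    (y : ℝ → RSpace n) : Prop where
  zero : y 0 = 0
  ac : AbsolutelyContinuousOnInterval y 0 τ
  exists_frame : ∃ f : ∀ t, RSpace n ≃ₗᵢ[ℝ] TSpace n (x t), IsHorizontal o τ x f ∧
    ∀ᵐ t ∂(volume : Measure ℝ), t ∈ Ioo 0 τ → f t (deriv y t) = velocity n x t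

end Rolling

end Rolling

end

/-! Both existence statements are equivalent to one condition that no longer mentions the manifolds:
there is a constant `A` in SO(n) with `deriv y' t = A (deriv y t)` for almost every `t`.

Take the parallel frames `f`, `f'` behind the two anti-developments. No twist makes `q` carry
parallel fields to parallel fields, so each matrix entry `⟨q f_i, f'_j⟩` has derivative zero almost
everywhere by metric compatibility. Being locally absolutely continuous, it is constant: `q t ∘ f t
= f' t ∘ A` (`IsRolling.apply_frame`). No slip then turns into the condition on `A`. Conversely, any
such `A` gives the rolling `f' t ∘ A ∘ (f t)⁻¹` (`isRolling_of_frames`). On `ℝⁿ` the covariant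
derivative is the ordinary one, and a rolling is itself a constant isometry
(`IsRolling.eq_ofTangentIsometry`, `isRolling_tangentIsometry`).

The geometric input is `hasDerivAt_inner`, computed in the chart around `x t`. Covariant derivatives
are afterwards identified by pairing with orthonormal parallel frames, so chart independence of
`covDeriv` is never needed. -/

namespace AbsolutelyContinuousOnInterval

/-! ### Calculus of absolutely continuous functions -/

open Filter Topology NNReal

variable {E F : Type*} [NormedAddCommGroup E] [NormedAddCommGroup F] {a b : ℝ}

theorem of_const (c : E) : AbsolutelyContinuousOnInterval (fun _ : ℝ => c) a b :=
  (LipschitzWith.const c).lipschitzOnWith.absolutelyContinuousOnInterval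

theorem finsetSum {ι : Type*} (s : Finset ι) {f : ι → ℝ → E}
    (h : ∀ i ∈ s, AbsolutelyContinuousOnInterval (f i) a b) :
    AbsolutelyContinuousOnInterval (fun t => ∑ i ∈ s, f i t) a b := by
  classical
  induction s using Finset.induction_on with
  | empty => simpa using of_const (0 : E)
  | insert i s his ih =>
    simp only [Finset.sum_insert his]
    exact (h i (Finset.mem_insert_self _ _)).fun_add
      (ih fun j hj => h j (Finset.mem_insert_of_mem hj))

variable [NormedSpace ℝ E] [NormedSpace ℝ F]

theorem lipschitzOnWith_comp {X Y : Type*} [PseudoMetricSpace X] [PseudoMetricSpace Y]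
    {K : ℝ≥0} {f : X → Y} {S : Set X} {g : ℝ → X} (hf : LipschitzOnWith K f S)
    (hg : AbsolutelyContinuousOnInterval g a b) (hS : MapsTo g (uIcc a b) S) :
    AbsolutelyContinuousOnInterval (fun t => f (g t)) a b := by
  unfold AbsolutelyContinuousOnInterval at hg ⊢
  refine squeeze_zero' (Eventually.of_forall fun _ => Finset.sum_nonneg fun _ _ => dist_nonneg) ?_
    (by simpa using hg.const_mul (K : ℝ))
  rw [eventually_inf_principal]
  filter_upwards with I hI
  rw [Finset.mul_sum]
  exact Finset.sum_le_sum fun i hi => hf.dist_le_mul _ (hS (hI.1 i hi).1) _ (hS (hI.1 i hi).2)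

theorem clm_comp (L : E →L[ℝ] F) {g : ℝ → E} (hg : AbsolutelyContinuousOnInterval g a b) :
    AbsolutelyContinuousOnInterval (fun t => L (g t)) a b :=
  lipschitzOnWith_comp (L.lipschitz.lipschitzOnWith (s := univ)) hg (mapsTo_univ _ _)

theorem congr {X : Type*} [PseudoMetricSpace X] {f g : ℝ → X}
    (hf : AbsolutelyContinuousOnInterval f a b)
    (h : EqOn f g (uIcc a b)) : AbsolutelyContinuousOnInterval g a b := by
  refine Tendsto.congr' ?_ hf
  filter_upwards [mem_inf_of_right (mem_principal_self _)] with I hI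
  exact Finset.sum_congr rfl fun i hi => by rw [h (hI.1 i hi).1, h (hI.1 i hi).2]

/-- A C¹ map is locally Lipschitz, hence Lipschitz on the compact image of the curve, and Lipschitz
maps preserve absolute continuity. -/
theorem contDiffOn_comp {f : E → F} {U : Set E} (hU : IsOpen U) (hf : ContDiffOn ℝ 1 f U)
    {g : ℝ → E} (hg : AbsolutelyContinuousOnInterval g a b) (hgU : MapsTo g (uIcc a b) U) :
    AbsolutelyContinuousOnInterval (fun t => f (g t)) a b := by
  have hl : LocallyLipschitzOn (g '' uIcc a b) f := by
    rintro _ ⟨t, ht, rfl⟩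
    obtain ⟨K, s, hs, hK⟩ :=
      (hf.contDiffAt (hU.mem_nhds (hgU ht))).exists_lipschitzOnWith
    exact ⟨K, s, mem_nhdsWithin_of_mem_nhds hs, hK⟩
  obtain ⟨K, hK⟩ := hl.exists_lipschitzOnWith_of_compact (isCompact_uIcc.image_of_continuousOn
    hg.continuousOn)
  exact lipschitzOnWith_comp hK hg (mapsTo_image _ _)

section Euclidean

variable {ι : Type*} [Fintype ι]

theorem euclidean_apply {g : ℝ → EuclideanSpace ℝ ι}
    (hg : AbsolutelyContinuousOnInterval g a b) (i : ι) :
    AbsolutelyContinuousOnInterval (fun t => g t i) a b :=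
  clm_comp (EuclideanSpace.proj i : EuclideanSpace ℝ ι →L[ℝ] ℝ) hg

theorem euclidean_of_apply [DecidableEq ι] {g : ℝ → EuclideanSpace ℝ ι}
    (hg : ∀ i, AbsolutelyContinuousOnInterval (fun t => g t i) a b) :
    AbsolutelyContinuousOnInterval g a b := by
  refine (finsetSum Finset.univ (f := fun i t => g t i • EuclideanSpace.single i (1 : ℝ))
    fun i _ => (hg i).fun_smul (of_const _)).congr fun t _ => ?_
  ext j
  simp [Finset.sum_apply, Pi.single_apply]

theorem clm_apply [DecidableEq ι] {L : ℝ → EuclideanSpace ℝ ι →L[ℝ] F} {g : ℝ → EuclideanSpace ℝ ι}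
    (hL : AbsolutelyContinuousOnInterval L a b) (hg : AbsolutelyContinuousOnInterval g a b) :
    AbsolutelyContinuousOnInterval (fun t => L t (g t)) a b := by
  refine (finsetSum Finset.univ
    (f := fun i t => g t i • L t (EuclideanSpace.single i (1 : ℝ)))
    fun i _ => (hg.euclidean_apply i).fun_smul
      (clm_comp (ContinuousLinearMap.apply ℝ F (EuclideanSpace.single i (1 : ℝ))) hL)).congr
    fun t _ => ?_
  have : g t = ∑ i, g t i • EuclideanSpace.single i (1 : ℝ) := by
    ext j
    simp [Finset.sum_apply, Pi.single_apply]
  conv_rhs => rw [this, map_sum]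
  simp

/-- An operator on a finite-dimensional space is a finite sum of rank-one operators built from its
columns. -/
theorem clm_of_apply [DecidableEq ι] {L : ℝ → EuclideanSpace ℝ ι →L[ℝ] F}
    (hL : ∀ i, AbsolutelyContinuousOnInterval
      (fun t => L t (EuclideanSpace.single i (1 : ℝ))) a b) :
    AbsolutelyContinuousOnInterval L a b := by
  refine (finsetSum Finset.univ (f := fun i t =>
    ContinuousLinearMap.smulRightL ℝ (EuclideanSpace ℝ ι) F
      (EuclideanSpace.proj i : EuclideanSpace ℝ ι →L[ℝ] ℝ)
      (L t (EuclideanSpace.single i (1 : ℝ)))) fun i _ => clm_comp _ (hL i)).congr fun t _ => ?_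
  ext v
  have : v = ∑ i, v i • EuclideanSpace.single i (1 : ℝ) := by
    ext j
    simp [Finset.sum_apply, Pi.single_apply]
  conv_rhs => rw [this, map_sum]
  simp

theorem ae_differentiableAt_euclidean {g : ℝ → EuclideanSpace ℝ ι}
    (hg : AbsolutelyContinuousOnInterval g a b) :
    ∀ᵐ t, t ∈ uIcc a b → DifferentiableAt ℝ g t := by
  have h := ae_all_iff.2 fun i => (hg.euclidean_apply i).ae_differentiableAt
  filter_upwards [h] with t ht hmem
  exact differentiableAt_euclidean.2 fun i => ht i hmem

end Euclidean

end AbsolutelyContinuousOnInterval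

namespace Rolling

open Filter Topology

/-! ### The metric and the Christoffel symbols in a chart -/

section Charts

variable {n : ℕ} {M : Type*} [TopologicalSpace M] [ChartedSpace (RSpace n) M]
  [IsManifold (𝓡 n) ∞ M]

theorem toCoord_ofCoord {p z : M} (hz : z ∈ (chartAt (RSpace n) p).source) (v : RSpace n) :
    toCoord n p z (ofCoord n p z v) = v :=
  Trivialization.continuousLinearMapAt_symmL _ hz v

theorem ofCoord_toCoord {p z : M} (hz : z ∈ (chartAt (RSpace n) p).source) (v : TSpace n z) :
    ofCoord n p z (toCoord n p z v) = v :=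
  Trivialization.symmL_continuousLinearMapAt _ hz v

theorem euclidean_eq_sum (v : RSpace n) :
    v = ∑ i, v i • EuclideanSpace.single i (1 : ℝ) := by
  ext j
  simp [Finset.sum_apply, Pi.single_apply]

theorem contMDiffOn_ofCoord (p : M) (v : RSpace n) :
    ContMDiffOn (𝓡 n) (𝓡 n).tangent 1
      (fun z : M => (⟨z, ofCoord n p z v⟩ : TangentBundle (𝓡 n) M))
      (chartAt (RSpace n) p).source := by
  have h := (trivializationAt (RSpace n) (TangentSpace (𝓡 n) : M → Type _)
    p).contMDiffOn_section_baseSet_iff (IB := 𝓡 n) (n := 1)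
    (s := fun z => ofCoord n p z v)
  refine h.2 ((contMDiffOn_const (c := v)).congr fun z hz => ?_)
  have h2 := toCoord_ofCoord (p := p) hz v
  unfold toCoord at h2
  exact (Trivialization.continuousLinearMapAt_apply_of_mem (R := ℝ) _ hz _).symm.trans h2

variable [RiemannianBundle (fun z : M => TangentSpace (𝓡 n) z)]

theorem metricMatrix_extChartAt {p z : M} (hz : z ∈ (chartAt (RSpace n) p).source) (i j : Fin n) :
    metricMatrix p (extChartAt (𝓡 n) p z) i j =
      inner ℝ (ofCoord n p z (EuclideanSpace.single i 1))
        (ofCoord n p z (EuclideanSpace.single j 1)) := by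
  have : (extChartAt (𝓡 n) p).symm (extChartAt (𝓡 n) p z) = z :=
    (extChartAt (𝓡 n) p).left_inv (by rwa [extChartAt_source])
  simp only [metricMatrix, Matrix.of_apply]
  rw [this]

theorem metricMatrix_symm (p : M) (u : RSpace n) (i j : Fin n) :
    metricMatrix p u i j = metricMatrix p u j i := by
  simp only [metricMatrix, Matrix.of_apply]
  exact real_inner_comm _ _

theorem inner_ofCoord {p z : M} (hz : z ∈ (chartAt (RSpace n) p).source) (v w : RSpace n) :
    inner ℝ (ofCoord n p z v) (ofCoord n p z w) =
      ∑ i, ∑ j, metricMatrix p (extChartAt (𝓡 n) p z) i j * v i * w j := by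
  conv_lhs => rw [euclidean_eq_sum v, euclidean_eq_sum w]
  simp only [map_sum, map_smul]
  rw [sum_inner]
  simp only [inner_sum, real_inner_smul_left, real_inner_smul_right, metricMatrix_extChartAt hz]
  refine Finset.sum_congr rfl fun i _ => Finset.sum_congr rfl fun j _ => by ring

theorem inner_eq_sum {p z : M} (hz : z ∈ (chartAt (RSpace n) p).source) (v w : TSpace n z) :
    inner ℝ v w = ∑ i, ∑ j, metricMatrix p (extChartAt (𝓡 n) p z) i j *
      toCoord n p z v i * toCoord n p z w j := by
  rw [← inner_ofCoord hz, ofCoord_toCoord hz, ofCoord_toCoord hz]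

theorem isUnit_metricMatrix_det {p z : M} (hz : z ∈ (chartAt (RSpace n) p).source) :
    IsUnit (metricMatrix p (extChartAt (𝓡 n) p z)).det := by
  rw [← Matrix.isUnit_iff_isUnit_det, ← Matrix.mulVec_injective_iff_isUnit]
  refine (injective_iff_map_eq_zero (Matrix.mulVecLin (metricMatrix p (extChartAt (𝓡 n) p z)))).2
    fun v hv => ?_
  -- A kernel vector of the Gram matrix gives a tangent vector of zero length.
  have h0 : inner ℝ (ofCoord n p z (WithLp.toLp 2 v)) (ofCoord n p z (WithLp.toLp 2 v)) = 0 := by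
    rw [inner_ofCoord hz]
    refine Finset.sum_eq_zero fun i _ => ?_
    have := congrFun hv i
    simp only [Matrix.mulVecLin_apply, Matrix.mulVec, dotProduct, Pi.zero_apply] at this
    calc _ = v i * ∑ j, metricMatrix p (extChartAt (𝓡 n) p z) i j * v j := by
          rw [Finset.mul_sum]
          exact Finset.sum_congr rfl fun j _ => by ring
      _ = 0 := by rw [this, mul_zero]
  have h1 := inner_self_eq_zero.1 h0
  have h2 := toCoord_ofCoord hz (WithLp.toLp 2 v)
  rw [h1, map_zero] at h2
  simpa using congrArg WithLp.ofLp h2.symm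

theorem metricPartial_symm (p : M) (u : RSpace n) (l i j : Fin n) :
    metricPartial p u l i j = metricPartial p u l j i := by
  simp only [metricPartial, metricMatrix_symm p _ i j]

/-- Lowering the upper index cancels the inverse metric in the definition of the Christoffel
symbols. -/
theorem sum_metricMatrix_mul_christoffel {p z : M} (hz : z ∈ (chartAt (RSpace n) p).source)
    (l i j : Fin n) :
    ∑ k, metricMatrix p (extChartAt (𝓡 n) p z) l k *
        christoffel p (extChartAt (𝓡 n) p z) k i j =
      1 / 2 * (metricPartial p (extChartAt (𝓡 n) p z) i j l +
        metricPartial p (extChartAt (𝓡 n) p z) j i l -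
        metricPartial p (extChartAt (𝓡 n) p z) l i j) := by
  set u := extChartAt (𝓡 n) p z
  set w : Fin n → ℝ := fun l => metricPartial p u i j l + metricPartial p u j i l -
    metricPartial p u l i j
  have h : (metricMatrix p u).mulVec ((metricMatrix p u)⁻¹.mulVec w) = w := by
    rw [Matrix.mulVec_mulVec, Matrix.mul_nonsing_inv _ (isUnit_metricMatrix_det hz),
      Matrix.one_mulVec]
  have h' := congrFun h l
  simp only [Matrix.mulVec, dotProduct] at h'
  change _ = 1 / 2 * w l
  rw [← h', Finset.mul_sum]
  refine Finset.sum_congr rfl fun k _ => ?_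
  simp only [christoffel, w]
  ring

/-- Metric compatibility in coordinates: in the sum of the two lowered symbols all derivatives
cancel, by symmetry of `g`, except two equal halves. -/
theorem metricPartial_eq {p z : M} (hz : z ∈ (chartAt (RSpace n) p).source) (i j l : Fin n) :
    metricPartial p (extChartAt (𝓡 n) p z) i j l =
      (∑ k, metricMatrix p (extChartAt (𝓡 n) p z) l k *
        christoffel p (extChartAt (𝓡 n) p z) k i j) +
      ∑ k, metricMatrix p (extChartAt (𝓡 n) p z) j k *
        christoffel p (extChartAt (𝓡 n) p z) k i l := by
  rw [sum_metricMatrix_mul_christoffel hz, sum_metricMatrix_mul_christoffel hz,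
    metricPartial_symm p _ i l j, metricPartial_symm p _ j i l, metricPartial_symm p _ l i j]
  ring

variable [IsContMDiffRiemannianBundle (𝓡 n) ∞ (EuclideanSpace ℝ (Fin n))
      (fun z : M => TangentSpace (𝓡 n) z)]

theorem contDiffOn_metricMatrix (p : M) (i j : Fin n) :
    ContDiffOn ℝ 1 (fun u => metricMatrix p u i j) (extChartAt (𝓡 n) p).target := by
  rw [← contMDiffOn_iff_contDiffOn]
  have : IsContMDiffRiemannianBundle (𝓡 n) 1 (EuclideanSpace ℝ (Fin n))
      (fun z : M => TangentSpace (𝓡 n) z) :=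
    IsContMDiffRiemannianBundle.of_le (n := ∞) (by exact_mod_cast le_top)
  have hs := contMDiffOn_extChartAt_symm (I := 𝓡 n) (n := 1) p
  have hm : MapsTo (extChartAt (𝓡 n) p).symm (extChartAt (𝓡 n) p).target
      (chartAt (RSpace n) p).source := by
    intro u hu
    rw [← extChartAt_source (𝓡 n)]
    exact (extChartAt (𝓡 n) p).map_target hu
  have h : ContMDiffOn (𝓡 n) 𝓘(ℝ, ℝ) 1 (fun z : M =>
      inner ℝ (ofCoord n p z (EuclideanSpace.single i 1))
        (ofCoord n p z (EuclideanSpace.single j 1))) (chartAt (RSpace n) p).source :=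
    ContMDiffOn.inner_bundle (contMDiffOn_ofCoord p _) (contMDiffOn_ofCoord p _)
  exact h.comp hs hm

end Charts

/-- Index bookkeeping for `hasDerivAt_inner`: the right side is the Christoffel term of the
covariant derivative of `z` along the velocity `u`, paired with `w`. -/
theorem sum_christoffel_reindex {ι : Type*} [Fintype ι] (g : ι → ι → ℝ) (Γ : ι → ι → ι → ℝ)
    (u z w : ι → ℝ) :
    ∑ i, ∑ j, (∑ l, u l * ∑ k, g k j * Γ k l i) * z i * w j =
      ∑ i, ∑ j, g i j * (∑ a, ∑ b, Γ i a b * u a * z b) * w j := by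
  rw [Finset.sum_comm, Finset.sum_comm (s := Finset.univ (α := ι)) (t := Finset.univ (α := ι))
    (f := fun i j => g i j * (∑ a, ∑ b, Γ i a b * u a * z b) * w j)]
  refine Finset.sum_congr rfl fun j _ => ?_
  simp only [Finset.mul_sum, Finset.sum_mul]
  rw [Finset.sum_comm]
  conv_rhs => rw [Finset.sum_comm]
  refine Finset.sum_congr rfl fun l _ => ?_
  rw [Finset.sum_comm]
  exact Finset.sum_congr rfl fun k _ => Finset.sum_congr rfl fun i _ => by ring

theorem frame_apply_eq_sum {n : ℕ} {E : Type*} [SeminormedAddCommGroup E] [Module ℝ E]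
    (f : RSpace n ≃ₗᵢ[ℝ] E) (c : RSpace n) :
    f c = ∑ i, c i • f (EuclideanSpace.single i (1 : ℝ)) := by
  conv_lhs => rw [euclidean_eq_sum c, map_sum]
  simp only [map_smul]

theorem deriv_euclidean_apply {n : ℕ} {c : ℝ → RSpace n} {t : ℝ} (hc : DifferentiableAt ℝ c t)
    (i : Fin n) : deriv (fun s => c s i) t = deriv c t i :=
  ((EuclideanSpace.proj i : RSpace n →L[ℝ] ℝ).hasFDerivAt.comp_hasDerivAt t hc.hasDerivAt).deriv

/-! ### Differentiable fields along a curve and metric compatibility -/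

section FieldsAlongCurves

variable {n : ℕ} {M : Type*} [TopologicalSpace M] [ChartedSpace (RSpace n) M]
  [IsManifold (𝓡 n) ∞ M]

/-- The vector field `Z` along the curve `x` is differentiable at time `t`. -/
def FieldDifferentiableAt (x : ℝ → M) (Z : ∀ t, TSpace n (x t)) (t : ℝ) : Prop :=
  MDifferentiableAt 𝓘(ℝ, ℝ) (𝓡 n).tangent (fun s => (⟨x s, Z s⟩ : TangentBundle (𝓡 n) M)) t

/-- Any chart around `x t` may be used. This transfers differentiability from a chart that serves a
whole time interval to the chart around `x t`, in which `covDeriv` is evaluated. -/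
theorem fieldDifferentiableAt_iff {x : ℝ → M} {Z : ∀ t, TSpace n (x t)} {t : ℝ} {p : M}
    (hp : x t ∈ (chartAt (RSpace n) p).source) :
    FieldDifferentiableAt x Z t ↔ MDifferentiableAt 𝓘(ℝ, ℝ) (𝓡 n) x t ∧
      DifferentiableAt ℝ (fun s => toCoord n p (x s) (Z s)) t := by
  unfold FieldDifferentiableAt
  rw [Trivialization.mdifferentiableAt_totalSpace_iff (𝓡 n)
    (trivializationAt (RSpace n) (TangentSpace (𝓡 n) : M → Type _) p) _ (by
      rw [Trivialization.mem_source]; exact hp)]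
  refine and_congr_right fun hx => ?_
  rw [mdifferentiableAt_iff_differentiableAt]
  refine EventuallyEq.differentiableAt_iff ?_
  filter_upwards [hx.continuousAt.preimage_mem_nhds
    ((chartAt (RSpace n) p).open_source.mem_nhds hp)] with s hs
  exact (Trivialization.continuousLinearMapAt_apply_of_mem (R := ℝ) _ hs _).symm

theorem mdifferentiableAt_curve_iff {x : ℝ → M} {t : ℝ} {p : M} (hc : ContinuousAt x t)
    (hp : x t ∈ (chartAt (RSpace n) p).source) :
    MDifferentiableAt 𝓘(ℝ, ℝ) (𝓡 n) x t ↔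
      DifferentiableAt ℝ (fun s => extChartAt (𝓡 n) p (x s)) t := by
  rw [mdifferentiableAt_iff_target_of_mem_source hp, mdifferentiableAt_iff_differentiableAt]
  exact and_iff_right hc

theorem FieldDifferentiableAt.curve {x : ℝ → M} {Z : ∀ t, TSpace n (x t)} {t : ℝ}
    (h : FieldDifferentiableAt x Z t) : MDifferentiableAt 𝓘(ℝ, ℝ) (𝓡 n) x t :=
  ((fieldDifferentiableAt_iff (mem_chart_source _ (x t))).1 h).1

theorem FieldDifferentiableAt.sum_smul {ι : Type*} [Fintype ι] {x : ℝ → M}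
    {Z : ι → ∀ t, TSpace n (x t)} {c : ι → ℝ → ℝ} {t : ℝ}
    (hx : MDifferentiableAt 𝓘(ℝ, ℝ) (𝓡 n) x t)
    (hZ : ∀ i, FieldDifferentiableAt x (Z i) t) (hc : ∀ i, DifferentiableAt ℝ (c i) t) :
    FieldDifferentiableAt x (fun s => ∑ i, c i s • Z i s) t := by
  have hp := mem_chart_source (RSpace n) (x t)
  refine (fieldDifferentiableAt_iff hp).2 ⟨hx, ?_⟩
  simp only [map_sum, map_smul]
  exact DifferentiableAt.fun_sum fun i _ =>
    (hc i).smul ((fieldDifferentiableAt_iff hp).1 (hZ i)).2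

variable [RiemannianBundle (fun z : M => TangentSpace (𝓡 n) z)]

theorem toCoord_covDeriv (x : ℝ → M) (Z : ∀ t, TSpace n (x t)) (t : ℝ) (k : Fin n) :
    toCoord n (x t) (x t) (covDeriv x Z t) k =
      deriv (fun s => toCoord n (x t) (x s) (Z s) k) t +
      ∑ i, ∑ j, christoffel (x t) (extChartAt (𝓡 n) (x t) (x t)) k i j *
        deriv (fun s => extChartAt (𝓡 n) (x t) (x s) i) t * toCoord n (x t) (x t) (Z t) j := by
  rw [covDeriv, covDerivInChart, toCoord_ofCoord (mem_chart_source _ (x t))]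

theorem FieldDifferentiableAt.frame_apply {x : ℝ → M}
    {f : ∀ t, RSpace n ≃ₗᵢ[ℝ] TSpace n (x t)} {t : ℝ}
    (hx : MDifferentiableAt 𝓘(ℝ, ℝ) (𝓡 n) x t)
    (hf : ∀ j, FieldDifferentiableAt x (fun s => f s (EuclideanSpace.single j 1)) t)
    {c : ℝ → RSpace n} (hc : DifferentiableAt ℝ c t) :
    FieldDifferentiableAt x (fun s => f s (c s)) t := by
  have h := FieldDifferentiableAt.sum_smul hx hf (c := fun i s => c s i)
    (differentiableAt_euclidean.1 hc)
  simpa only [← frame_apply_eq_sum] using h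

variable [IsContMDiffRiemannianBundle (𝓡 n) ∞ (EuclideanSpace ℝ (Fin n))
      (fun z : M => TangentSpace (𝓡 n) z)]

theorem hasDerivAt_metricMatrix {x : ℝ → M} {t : ℝ} {p : M}
    (hp : x t ∈ (chartAt (RSpace n) p).source) (hx : MDifferentiableAt 𝓘(ℝ, ℝ) (𝓡 n) x t)
    (i j : Fin n) :
    HasDerivAt (fun s => metricMatrix p (extChartAt (𝓡 n) p (x s)) i j)
      (∑ l, deriv (fun s => extChartAt (𝓡 n) p (x s) l) t *
        metricPartial p (extChartAt (𝓡 n) p (x t)) l i j) t := by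
  have hu := (mdifferentiableAt_curve_iff hx.continuousAt hp).1 hx
  have ht : extChartAt (𝓡 n) p (x t) ∈ (extChartAt (𝓡 n) p).target :=
    (extChartAt (𝓡 n) p).map_source (by rwa [extChartAt_source])
  have hg : DifferentiableAt ℝ (fun u => metricMatrix p u i j) (extChartAt (𝓡 n) p (x t)) :=
    ((contDiffOn_metricMatrix p i j).contDiffAt
      ((isOpen_extChartAt_target p).mem_nhds ht)).differentiableAt one_ne_zero
  have h := hg.hasFDerivAt.comp_hasDerivAt t hu.hasDerivAt
  refine h.congr_deriv ?_
  have hd : ∀ l, deriv (fun s => extChartAt (𝓡 n) p (x s) l) t =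
      deriv (fun s => extChartAt (𝓡 n) p (x s)) t l := 
    deriv_euclidean_apply hu
  rw [euclidean_eq_sum (deriv (fun s => extChartAt (𝓡 n) p (x s)) t), map_sum]
  simp only [map_smul, smul_eq_mul, metricPartial, hd]

/-- The Levi-Civita connection is compatible with the metric. -/
theorem hasDerivAt_inner {x : ℝ → M} {Z W : ∀ t, TSpace n (x t)} {t : ℝ}
    (hZ : FieldDifferentiableAt x Z t) (hW : FieldDifferentiableAt x W t) :
    HasDerivAt (fun s => inner ℝ (Z s) (W s))
      (inner ℝ (covDeriv x Z t) (W t) + inner ℝ (Z t) (covDeriv x W t)) t := by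
  have hp := mem_chart_source (RSpace n) (x t)
  have hx := hZ.curve
  obtain ⟨-, hz⟩ := (fieldDifferentiableAt_iff hp).1 hZ
  obtain ⟨-, hw⟩ := (fieldDifferentiableAt_iff hp).1 hW
  have hz' := fun i => (differentiableAt_euclidean.1 hz i).hasDerivAt
  have hw' := fun i => (differentiableAt_euclidean.1 hw i).hasDerivAt
  have hev : (fun s => inner ℝ (Z s) (W s)) =ᶠ[𝓝 t] fun s =>
      ∑ i, ∑ j, metricMatrix (x t) (extChartAt (𝓡 n) (x t) (x s)) i j *
        toCoord n (x t) (x s) (Z s) i * toCoord n (x t) (x s) (W s) j := by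
    filter_upwards [hx.continuousAt.preimage_mem_nhds
      ((chartAt (RSpace n) (x t)).open_source.mem_nhds hp)] with s hs
    exact inner_eq_sum hs _ _
  refine HasDerivAt.congr_of_eventuallyEq ?_ hev
  set u := extChartAt (𝓡 n) (x t) (x t)
  set g := metricMatrix (x t) u
  set Γ := christoffel (x t) u
  set u' := fun l => deriv (fun s => extChartAt (𝓡 n) (x t) (x s) l) t
  set z := toCoord n (x t) (x t) (Z t)
  set w := toCoord n (x t) (x t) (W t)
  set z' := fun i => deriv (fun s => toCoord n (x t) (x s) (Z s) i) t
  set w' := fun i => deriv (fun s => toCoord n (x t) (x s) (W s) i) t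
  have hsum := HasDerivAt.fun_sum (u := Finset.univ) fun i _ =>
    HasDerivAt.fun_sum (u := Finset.univ) fun j _ =>
      ((((hasDerivAt_metricMatrix hp hx i j).mul (hz' i)).mul (hw' j)).congr_deriv
        (show _ = ((∑ l, u' l * metricPartial (x t) u l i j) * z i + g i j * z' i) * w j +
          g i j * z i * w' j from rfl))
  refine hsum.congr_deriv ?_
  have hDZ : ∀ k, toCoord n (x t) (x t) (covDeriv x Z t) k =
      z' k + ∑ a, ∑ b, Γ k a b * u' a * z b := toCoord_covDeriv x Z t
  have hDW : ∀ k, toCoord n (x t) (x t) (covDeriv x W t) k =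
      w' k + ∑ a, ∑ b, Γ k a b * u' a * w b := toCoord_covDeriv x W t
  rw [inner_eq_sum hp, inner_eq_sum hp]
  simp only [hDZ, hDW]
  have hgs : ∀ i j, g i j = g j i := metricMatrix_symm _ _
  have e1 := sum_christoffel_reindex g Γ u' z w
  have e2 := sum_christoffel_reindex g Γ u' w z
  have hG : ∀ l i j, metricPartial (x t) u l i j =
      (∑ k, g k j * Γ k l i) + ∑ k, g k i * Γ k l j := fun l i j => by
    rw [metricPartial_eq hp l i j]
    simp only [hgs _ j, hgs _ i]
    rfl
  -- The same reindexing with the roles of `Z` and `W` exchanged, using the symmetry of `g`.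
  have e2' : ∑ i, ∑ j, (∑ l, u' l * ∑ k, g k i * Γ k l j) * z i * w j =
      ∑ i, ∑ j, g i j * z i * (∑ a, ∑ b, Γ j a b * u' a * w b) := by
    rw [Finset.sum_comm]
    conv_rhs => rw [Finset.sum_comm]
    calc _ = _ := Finset.sum_congr rfl fun i _ => Finset.sum_congr rfl fun j _ => by ring
      _ = _ := e2
      _ = _ := Finset.sum_congr rfl fun i _ => Finset.sum_congr rfl fun j _ => by
        rw [hgs i j]; ring
  calc _ = ∑ i, ∑ j, ((∑ l, u' l * ∑ k, g k j * Γ k l i) * z i * w j +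
        (∑ l, u' l * ∑ k, g k i * Γ k l j) * z i * w j +
        (g i j * z' i * w j + g i j * z i * w' j)) := by
        refine Finset.sum_congr rfl fun i _ => Finset.sum_congr rfl fun j _ => ?_
        simp only [hG, mul_add, Finset.sum_add_distrib]
        ring
    _ = _ := by
        simp only [Finset.sum_add_distrib, e1, e2', mul_add, add_mul]
        abel

/-! ### Differentiation in parallel orthonormal frames -/

section Frames

variable {x : ℝ → M} {f : ∀ t, RSpace n ≃ₗᵢ[ℝ] TSpace n (x t)} {t : ℝ}

/-- Coordinates in an orthonormal frame are inner products with the frame vectors. -/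
theorem FieldDifferentiableAt.frame_symm_apply
    (hf : ∀ j, FieldDifferentiableAt x (fun s => f s (EuclideanSpace.single j 1)) t)
    {Z : ∀ t, TSpace n (x t)} (hZ : FieldDifferentiableAt x Z t) :
    DifferentiableAt ℝ (fun s => (f s).symm (Z s)) t := by
  refine differentiableAt_euclidean.2 fun i => ?_
  have h := (hasDerivAt_inner (hf i) hZ).differentiableAt
  refine h.congr_of_eventuallyEq (Eventually.of_forall fun s => ?_)
  have h2 := (f s).inner_map_map (EuclideanSpace.single i 1) ((f s).symm (Z s))
  rw [(f s).apply_symm_apply] at h2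
  simp [h2, EuclideanSpace.inner_single_left]

/-- Differentiating `⟨f_i, f c⟩ = c_i` leaves only `⟨f_i, D(f c)/dt⟩`, because `f_i` is parallel.
These inner products determine the covariant derivative, so no Leibniz rule for `covDeriv` is
required. -/
theorem covDeriv_frame_apply (hx : MDifferentiableAt 𝓘(ℝ, ℝ) (𝓡 n) x t)
    (hf : ∀ j, FieldDifferentiableAt x (fun s => f s (EuclideanSpace.single j 1)) t)
    (hpar : ∀ j, covDeriv x (fun s => f s (EuclideanSpace.single j 1)) t = 0)
    {c : ℝ → RSpace n} (hc : DifferentiableAt ℝ c t) :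
    covDeriv x (fun s => f s (c s)) t = f t (deriv c t) := by
  apply (f t).symm.injective
  rw [(f t).symm_apply_apply]
  ext i
  have h := hasDerivAt_inner (hf i) (FieldDifferentiableAt.frame_apply hx hf hc)
  rw [hpar i, inner_zero_left, zero_add] at h
  simp only [(f _).inner_map_map] at h
  have h2 := (f t).inner_map_map (EuclideanSpace.single i 1)
    ((f t).symm (covDeriv x (fun s => f s (c s)) t))
  rw [(f t).apply_symm_apply] at h2
  rw [h2] at h
  simp only [EuclideanSpace.inner_single_left, map_one, one_mul] at h
  exact h.unique ((differentiableAt_euclidean.1 hc i).hasDerivAt.congr_deriv (deriv_euclidean_apply hc i))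

end Frames

end FieldsAlongCurves

/-! ### From local to global on the time interval -/

theorem exists_Icc_subset_of_mem_nhdsWithin {τ t₀ : ℝ} {S : Set ℝ} (ht : t₀ ∈ Icc 0 τ)
    (hS : S ∈ 𝓝[Icc 0 τ] t₀) :
    ∃ a b, 0 ≤ a ∧ a ≤ b ∧ b ≤ τ ∧ Icc a b ∈ 𝓝[Icc 0 τ] t₀ ∧ Icc a b ⊆ S := by
  obtain ⟨ε, hε, h⟩ := Metric.mem_nhdsWithin_iff.1 hS
  have h1 := ht.1
  have h2 := ht.2
  refine ⟨max 0 (t₀ - ε / 2), min τ (t₀ + ε / 2), le_max_left _ _, ?_, min_le_left _ _, ?_, ?_⟩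
  · exact (max_le h1 (by linarith)).trans (le_min h2 (by linarith))
  · refine Metric.mem_nhdsWithin_iff.2 ⟨ε / 2, by positivity, fun s hs => ?_⟩
    have h3 := abs_lt.1 (Real.dist_eq s t₀ ▸ Metric.mem_ball.1 hs.1)
    exact ⟨max_le hs.2.1 (by linarith [h3.1]), le_min hs.2.2 (by linarith [h3.2])⟩
  · intro s hs
    have h3 := max_le_iff.1 hs.1
    have h4 := le_min_iff.1 hs.2
    refine h ⟨Metric.mem_ball.2 ?_, h3.1, h4.1⟩
    rw [Real.dist_eq, abs_lt]
    constructor <;> linarith [h3.2, h4.2]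

theorem ae_Ioo_of_locally {τ : ℝ} {P : ℝ → Prop}
    (h : ∀ t₀ ∈ Icc 0 τ, ∃ a b, Icc a b ∈ 𝓝[Icc 0 τ] t₀ ∧
      ∀ᵐ t ∂(volume : Measure ℝ), t ∈ Ioo a b → P t) :
    ∀ᵐ t ∂(volume : Measure ℝ), t ∈ Ioo 0 τ → P t := by
  have h0 : volume {t | t ∈ Ioo 0 τ ∧ ¬ P t} = 0 := by
    refine measure_null_of_locally_null _ fun t₀ ht₀ => ?_
    obtain ⟨a, b, hab, hae⟩ := h t₀ (Ioo_subset_Icc_self ht₀.1)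
    -- At an interior time a relative neighbourhood is a true one, so `t₀` lies in the open interval
    -- `Ioo a b`.
    rw [nhdsWithin_eq_nhds.2 (Icc_mem_nhds ht₀.1.1 ht₀.1.2), Icc_mem_nhds_iff] at hab
    refine ⟨Ioo a b ∩ {t | t ∈ Ioo 0 τ ∧ ¬ P t}, inter_mem
      (mem_nhdsWithin_of_mem_nhds (Ioo_mem_nhds hab.1 hab.2)) self_mem_nhdsWithin, ?_⟩
    refine measure_mono_null ?_ (ae_iff.1 hae)
    rintro t ⟨h1, -, h2⟩
    exact fun h3 => h2 (h3 h1)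
  rw [ae_iff]
  convert h0 using 2
  ext t
  simp [and_assoc]

/-- On each small interval absolute continuity and a derivative vanishing almost everywhere force
constancy; a locally constant function on `[0, τ]` is constant. -/
theorem eq_of_locally_absolutelyContinuous {E : Type*} [NormedAddCommGroup E] [NormedSpace ℝ E]
    {τ : ℝ} {F : ℝ → E}
    (h : ∀ t₀ ∈ Icc 0 τ, ∃ a b, 0 ≤ a ∧ a ≤ b ∧ b ≤ τ ∧ Icc a b ∈ 𝓝[Icc 0 τ] t₀ ∧
      AbsolutelyContinuousOnInterval F a b)
    (hF : ∀ᵐ t ∂(volume : Measure ℝ), t ∈ Ioo 0 τ → HasDerivAt F 0 t) :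
    ∀ t ∈ Icc 0 τ, F t = F 0 := by
  -- The two endpoints form a null set.
  have hF' : ∀ᵐ t ∂(volume : Measure ℝ), t ∈ Icc 0 τ → HasDerivAt F 0 t := by
    have h0 : ∀ᵐ t ∂(volume : Measure ℝ), t ≠ 0 := by simp [ae_iff]
    have h1 : ∀ᵐ t ∂(volume : Measure ℝ), t ≠ τ := by simp [ae_iff]
    filter_upwards [hF, h0, h1] with t ht ht0 ht1 hm
    exact ht ⟨lt_of_le_of_ne hm.1 ht0.symm, lt_of_le_of_ne hm.2 ht1⟩
  have hloc : ∀ t₀ ∈ Icc 0 τ, F =ᶠ[𝓝[Icc 0 τ] t₀] fun _ => F t₀ := by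
    intro t₀ ht₀
    obtain ⟨a, b, ha, hab, hb, hn, hac⟩ := h t₀ ht₀
    obtain ⟨C, hC⟩ := hac.const_of_ae_hasDerivAt_zero (by
      filter_upwards [hF'] with t ht hm
      rw [uIcc_of_le hab] at hm
      exact ht ⟨ha.trans hm.1, hm.2.trans hb⟩)
    rw [uIcc_of_le hab] at hC
    filter_upwards [hn] with t ht
    rw [hC t ht, hC t₀ (mem_of_mem_nhdsWithin ht₀ hn)]
  refine constant_of_has_deriv_right_zero (fun t ht => ?_) fun t ht => ?_
  · exact continuousWithinAt_const.congr_of_eventuallyEq_of_mem (hloc t ht) ht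
  · have h1 := ((hasDerivWithinAt_const t (Icc 0 τ) (F t)).congr_of_eventuallyEq_of_mem
      (hloc t (Ico_subset_Icc_self ht)) (Ico_subset_Icc_self ht))
    exact h1.mono_of_mem_nhdsWithin (mem_of_superset (Icc_mem_nhdsGE_of_mem ⟨le_rfl, ht.2⟩)
      (Icc_subset_Icc_left ht.1))

/-! ### Absolutely continuous fields along absolutely continuous curves -/

section

variable {n : ℕ} {M : Type*} [TopologicalSpace M] [ChartedSpace (RSpace n) M]
  {τ : ℝ} {x : ℝ → M}

theorem chartAt_source_mem_nhdsWithin (hx : ContinuousOn x (Icc 0 τ)) {t₀ : ℝ}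
    (ht : t₀ ∈ Icc 0 τ) :
    x ⁻¹' (chartAt (RSpace n) (x t₀)).source ∈ 𝓝[Icc 0 τ] t₀ :=
  (hx t₀ ht).preimage_mem_nhdsWithin
    ((chartAt (RSpace n) (x t₀)).open_source.mem_nhds (mem_chart_source _ _))

variable [IsManifold (𝓡 n) ∞ M]

theorem ae_fieldDifferentiableAt_of_chart {p : M} {a b : ℝ} (hab : a ≤ b)
    {Z : ∀ t, TSpace n (x t)}
    (hc : ContinuousOn x (Icc a b)) (hp : MapsTo x (Icc a b) (chartAt (RSpace n) p).source)
    (hu : AbsolutelyContinuousOnInterval (fun t => extChartAt (𝓡 n) p (x t)) a b)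
    (hz : AbsolutelyContinuousOnInterval (fun t => toCoord n p (x t) (Z t)) a b) :
    ∀ᵐ t ∂(volume : Measure ℝ), t ∈ Ioo a b → FieldDifferentiableAt x Z t := by
  filter_upwards [hu.ae_differentiableAt_euclidean, hz.ae_differentiableAt_euclidean]
    with t h1 h2 ht
  have ht' := Ioo_subset_Icc_self ht
  rw [uIcc_of_le hab] at h1 h2
  exact (fieldDifferentiableAt_iff (hp ht')).2 ⟨(mdifferentiableAt_curve_iff
    (hc.continuousAt (Icc_mem_nhds ht.1 ht.2)) (hp ht')).2 (h1 ht'), h2 ht'⟩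

theorem ACField.ae_fieldDifferentiableAt {Z : ∀ t, TSpace n (x t)} (hZ : ACField τ x Z)
    (hx : ACCurve n τ x) :
    ∀ᵐ t ∂(volume : Measure ℝ), t ∈ Ioo 0 τ → FieldDifferentiableAt x Z t := by
  refine ae_Ioo_of_locally fun t₀ ht₀ => ?_
  obtain ⟨a, b, ha, hab, hb, hn, hS⟩ := exists_Icc_subset_of_mem_nhdsWithin ht₀
    (chartAt_source_mem_nhdsWithin (n := n) hx.continuousOn ht₀)
  exact ⟨a, b, hn, ae_fieldDifferentiableAt_of_chart hab
    (hx.continuousOn.mono (Icc_subset_Icc ha hb)) hS (hx.inChart _ a b ha hab hb hS)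
    (hZ _ a b ha hab hb hS)⟩

theorem ACCurve.ae_mdifferentiableAt (hx : ACCurve n τ x) :
    ∀ᵐ t ∂(volume : Measure ℝ), t ∈ Ioo 0 τ → MDifferentiableAt 𝓘(ℝ, ℝ) (𝓡 n) x t := by
  -- The zero field is absolutely continuous, and its differentiability includes that of the base
  -- curve.
  have h : ACField (n := n) τ x (fun _ => 0) := fun p a b _ _ _ _ => by
    simpa only [map_zero] using AbsolutelyContinuousOnInterval.of_const 0
  filter_upwards [h.ae_fieldDifferentiableAt hx] with t ht hm using (ht hm).curve

variable [RiemannianBundle (fun z : M => TangentSpace (𝓡 n) z)]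
  [IsContMDiffRiemannianBundle (𝓡 n) ∞ (EuclideanSpace ℝ (Fin n))
      (fun z : M => TangentSpace (𝓡 n) z)]

/-- In the chart the inner product is a sum of products of `g_{ij}` along the curve and coordinates,
all absolutely continuous. -/
theorem absolutelyContinuous_inner {p : M} {a b : ℝ} (hab : a ≤ b)
    {Z W : ∀ t, TSpace n (x t)} (hp : MapsTo x (Icc a b) (chartAt (RSpace n) p).source)
    (hu : AbsolutelyContinuousOnInterval (fun t => extChartAt (𝓡 n) p (x t)) a b)
    (hz : AbsolutelyContinuousOnInterval (fun t => toCoord n p (x t) (Z t)) a b)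
    (hw : AbsolutelyContinuousOnInterval (fun t => toCoord n p (x t) (W t)) a b) :
    AbsolutelyContinuousOnInterval (fun t => inner ℝ (Z t) (W t)) a b := by
  have hg : ∀ i j, AbsolutelyContinuousOnInterval
      (fun t => metricMatrix p (extChartAt (𝓡 n) p (x t)) i j) a b := fun i j =>
    AbsolutelyContinuousOnInterval.contDiffOn_comp (isOpen_extChartAt_target p)
      (contDiffOn_metricMatrix p i j) hu fun t ht =>
        (extChartAt (𝓡 n) p).map_source (by
          rw [extChartAt_source]
          exact hp (by rwa [uIcc_of_le hab] at ht))
  refine (AbsolutelyContinuousOnInterval.finsetSum Finset.univ fun i _ =>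
    AbsolutelyContinuousOnInterval.finsetSum Finset.univ fun j _ =>
      ((hg i j).fun_mul (hz.euclidean_apply i)).fun_mul (hw.euclidean_apply j)).congr
      fun t ht => ?_
  rw [uIcc_of_le hab] at ht
  exact (inner_eq_sum (hp ht) _ _).symm

end

/-! ### Euclidean space as a manifold -/

section Euclidean

variable {n : ℕ}

theorem toCoord_euclidean (p z : RSpace n) (v : RSpace n) :
    toCoord n p z v = v :=
  congrArg (fun A : RSpace n →L[ℝ] RSpace n => A v)
    (TangentBundle.continuousLinearMapAt_model_space (𝕜 := ℝ) (F := RSpace n) p z)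

theorem ofCoord_euclidean (p z : RSpace n) (v : RSpace n) :
    ofCoord n p z v = v :=
  congrArg (fun A : RSpace n →L[ℝ] RSpace n => A v)
    (TangentBundle.symmL_model_space (𝕜 := ℝ) (F := RSpace n) p z)

/-- The chart is the identity, so the metric matrix is constant. -/
theorem christoffel_euclidean (p u : RSpace n) (k i j : Fin n) : christoffel p u k i j = 0 := by
  have h : ∀ l i j, metricPartial p u l i j = 0 := by
    intro l i j
    have : (fun w : RSpace n => metricMatrix p w i j) = fun _ =>
        inner ℝ (EuclideanSpace.single i (1 : ℝ)) (EuclideanSpace.single j (1 : ℝ)) := by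
      funext w
      simp only [metricMatrix, Matrix.of_apply]
      rw [ofCoord_euclidean, ofCoord_euclidean]
      rfl
    rw [metricPartial, this]
    simp
  simp [christoffel, h]

theorem covDeriv_euclidean {y : ℝ → RSpace n} {Z : ℝ → RSpace n} {t : ℝ}
    (hZ : DifferentiableAt ℝ Z t) :
    covDeriv (n := n) y Z t = deriv Z t := by
  refine (ofCoord_euclidean _ _ _).trans ?_
  refine PiLp.ext fun k => ?_
  simp only [christoffel_euclidean, zero_mul, Finset.sum_const_zero, add_zero]
  rw [← deriv_euclidean_apply hZ]
  congr 1
  funext s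
  rw [toCoord_euclidean]

theorem acCurve_euclidean {τ : ℝ} {y : ℝ → RSpace n} (hτ : 0 ≤ τ)
    (hy : AbsolutelyContinuousOnInterval y 0 τ) : ACCurve n τ y where
  continuousOn := by simpa [uIcc_of_le hτ] using hy.continuousOn
  inChart p a b ha hab hb _ := by
    exact hy.mono (by rw [uIcc_of_le hτ, uIcc_of_le hab]; exact Icc_subset_Icc ha hb)

theorem velocity_euclidean (y : ℝ → RSpace n) (t : ℝ) : velocity n y t = deriv y t := by
  rw [velocity, mfderiv_eq_fderiv]
  exact fderiv_apply_one_eq_deriv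

theorem acField_euclidean_iff {τ : ℝ} {y : ℝ → RSpace n} {Z : ℝ → RSpace n} (hτ : 0 ≤ τ) :
    ACField (n := n) τ y Z ↔ AbsolutelyContinuousOnInterval Z 0 τ := by
  constructor
  · intro h
    have := h 0 0 τ le_rfl hτ le_rfl (fun t _ => mem_univ _)
    simpa only [toCoord_euclidean] using this
  · intro h p a b ha hab hb _
    simp only [toCoord_euclidean]
    exact h.mono (by rw [uIcc_of_le hτ, uIcc_of_le hab]; exact Icc_subset_Icc ha hb)

end Euclidean

/-! ### Orientations, and rollings of Euclidean space on itself -/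

theorem orientation_map_trans_apply {V₁ V₂ V₃ ι : Type*} [AddCommGroup V₁] [AddCommGroup V₂]
    [AddCommGroup V₃] [Module ℝ V₁] [Module ℝ V₂] [Module ℝ V₃]
    (e : V₁ ≃ₗ[ℝ] V₂) (e' : V₂ ≃ₗ[ℝ] V₃) (o : Orientation ℝ V₁ ι) :
    Orientation.map ι (e.trans e') o = Orientation.map ι e' (Orientation.map ι e o) := by
  induction o using Module.Ray.ind with
  | h v hv => rfl

theorem orientation_map_symm_apply {V₁ V₂ ι : Type*} [AddCommGroup V₁] [AddCommGroup V₂]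
    [Module ℝ V₁] [Module ℝ V₂]
    (e : V₁ ≃ₗ[ℝ] V₂) {o : Orientation ℝ V₁ ι} {o' : Orientation ℝ V₂ ι}
    (h : Orientation.map ι e o = o') : Orientation.map ι e.symm o' = o := by
  rw [← h]
  exact (Orientation.map ι e).symm_apply_apply o

section Euclidean

variable {n : ℕ}

/-- A linear isometry of `ℝⁿ` as a linear isometry between tangent spaces of `ℝⁿ`. -/
noncomputable def tangentIsometry (A : RSpace n ≃ₗᵢ[ℝ] RSpace n) (u v : RSpace n) :
    TSpace n u ≃ₗᵢ[ℝ] TSpace n v where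
  toLinearEquiv := (A.toLinearEquiv : RSpace n ≃ₗ[ℝ] RSpace n)
  norm_map' w := by
    rw [norm_tangentSpace_vectorSpace, norm_tangentSpace_vectorSpace]
    exact A.norm_map w

/-- A linear isometry between tangent spaces of `ℝⁿ` as a linear isometry of `ℝⁿ`. -/
noncomputable def ofTangentIsometry {u v : RSpace n} (B : TSpace n u ≃ₗᵢ[ℝ] TSpace n v) :
    RSpace n ≃ₗᵢ[ℝ] RSpace n where
  toLinearEquiv := (B.toLinearEquiv : TSpace n u ≃ₗ[ℝ] TSpace n v)
  norm_map' w := by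
    have h (w : TSpace n u) : ‖B w‖ = ‖w‖ := B.norm_map w
    simp only [norm_tangentSpace_vectorSpace] at h
    exact h w

/-- A constant orientation preserving isometry rolls `ℝⁿ` on itself along curves whose velocities
it intertwines. -/
theorem isRolling_tangentIsometry {τ : ℝ} (hτ : 0 ≤ τ) {y y' : ℝ → RSpace n}
    (hy : AbsolutelyContinuousOnInterval y 0 τ) (hy' : AbsolutelyContinuousOnInterval y' 0 τ)
    (A : RSpace n ≃ₗᵢ[ℝ] RSpace n)
    (hA : Orientation.map (Fin n) A.toLinearEquiv (stdOrientation n) = stdOrientation n)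
    (hd : ∀ᵐ t ∂(volume : Measure ℝ), t ∈ Ioo 0 τ → deriv y' t = A (deriv y t)) :
    IsRolling (euclideanOrientation n) (euclideanOrientation n) τ y y'
      (fun t => tangentIsometry A (y t) (y' t)) where
  oriented _ _ := hA
  ac_fst := acCurve_euclidean hτ hy
  ac_snd := acCurve_euclidean hτ hy'
  ac p p' a b _ _ _ _ _ := by
    refine (AbsolutelyContinuousOnInterval.of_const
      ((A.toContinuousLinearEquiv : RSpace n →L[ℝ] RSpace n))).congr fun t _ => ?_
    refine ContinuousLinearMap.ext fun v => ?_
    refine Eq.trans ?_ (toCoord_euclidean p' (y' t) _).symm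
    exact congrArg A (ofCoord_euclidean p (y t) v).symm
  no_slip := by
    filter_upwards [hd] with t ht hm
    rw [velocity_euclidean, velocity_euclidean]
    exact ht hm
  no_twist Z hZ := by
    have hZ' := (acField_euclidean_iff (Z := Z) hτ).1 hZ
    filter_upwards [hZ'.ae_differentiableAt_euclidean] with t ht hm
    rw [uIcc_of_le hτ] at ht
    have h1 : DifferentiableAt ℝ (fun s => (Z s : RSpace n)) t := ht (Ioo_subset_Icc_self hm)
    have h2 : HasDerivAt (fun s => A (Z s)) (A (deriv (fun s => (Z s : RSpace n)) t)) t :=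
      (A.toContinuousLinearEquiv : RSpace n →L[ℝ] RSpace n).hasFDerivAt.comp_hasDerivAt t
        h1.hasDerivAt
    have e1 := covDeriv_euclidean (y := y) h1
    have e2 := covDeriv_euclidean (y := y') h2.differentiableAt
    rw [h2.deriv] at e2
    exact (congrArg A e1).trans e2.symm

/-- A rolling of `ℝⁿ` on itself is constant. -/
theorem IsRolling.eq_ofTangentIsometry {τ : ℝ} (hτ : 0 ≤ τ) {y y' : ℝ → RSpace n}
    {q : ∀ t, TSpace n (y t) ≃ₗᵢ[ℝ] TSpace n (y' t)}
    (hq : IsRolling (euclideanOrientation n) (euclideanOrientation n) τ y y' q) :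
    ∀ t ∈ Icc 0 τ, ∀ v : RSpace n, q t v = ofTangentIsometry (q 0) v := by
  let B : ℝ → RSpace n ≃ₗᵢ[ℝ] RSpace n := fun t => ofTangentIsometry (q t)
  suffices h : ∀ t ∈ Icc 0 τ, ∀ v : RSpace n, B t v = B 0 v from h
  have hB : ∀ i, ∀ t ∈ Icc 0 τ, B t (EuclideanSpace.single i 1) =
      B 0 (EuclideanSpace.single i 1) := by
    intro i
    set e : RSpace n := EuclideanSpace.single i 1
    have hac : AbsolutelyContinuousOnInterval (fun t => B t e) 0 τ := by
      refine (AbsolutelyContinuousOnInterval.clm_apply (hq.ac 0 0 0 τ le_rfl hτ le_rfl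
        (fun t _ => mem_univ _) (fun t _ => mem_univ _))
        (AbsolutelyContinuousOnInterval.of_const e)).congr fun t _ => ?_
      refine (toCoord_euclidean 0 (y' t) _).trans ?_
      exact congrArg (B t) (ofCoord_euclidean 0 (y t) e)
    refine eq_of_locally_absolutelyContinuous
      (fun t₀ _ => ⟨0, τ, le_rfl, hτ, le_rfl, self_mem_nhdsWithin, hac⟩) ?_
    -- No twist for the constant field `e`: the derivative of `B t e` is `B t 0 = 0`.
    filter_upwards [hac.ae_differentiableAt_euclidean, hq.no_twist (fun _ => e)
      ((acField_euclidean_iff hτ).2 (AbsolutelyContinuousOnInterval.of_const e))] with t h1 h2 hm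
    rw [uIcc_of_le hτ] at h1
    have h1' := h1 (Ioo_subset_Icc_self hm)
    have e1 := covDeriv_euclidean (y := y) (differentiableAt_const e : DifferentiableAt ℝ _ t)
    have e2 := covDeriv_euclidean (y := y') h1'
    rw [deriv_const] at e1
    have h3 : (deriv (fun t => B t e) t : RSpace n) = B t 0 :=
      e2.symm.trans ((h2 hm).symm.trans (congrArg (q t) e1))
    rw [map_zero] at h3
    exact h3 ▸ h1'.hasDerivAt
  intro t ht v
  rw [frame_apply_eq_sum (B t), frame_apply_eq_sum (B 0)]
  exact Finset.sum_congr rfl fun i _ => by rw [hB i t ht]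

end Euclidean

/-! ### Rollings in terms of parallel frames -/

theorem exists_Icc_mapsTo_charts {n : ℕ} {M M' : Type*} [TopologicalSpace M]
    [ChartedSpace (RSpace n) M] [TopologicalSpace M'] [ChartedSpace (RSpace n) M'] {τ : ℝ}
    {x : ℝ → M} {x' : ℝ → M'} (hx : ContinuousOn x (Icc 0 τ)) (hx' : ContinuousOn x' (Icc 0 τ))
    {t₀ : ℝ} (ht : t₀ ∈ Icc 0 τ) :
    ∃ a b, 0 ≤ a ∧ a ≤ b ∧ b ≤ τ ∧ Icc a b ∈ 𝓝[Icc 0 τ] t₀ ∧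
      MapsTo x (Icc a b) (chartAt (RSpace n) (x t₀)).source ∧
      MapsTo x' (Icc a b) (chartAt (RSpace n) (x' t₀)).source := by
  obtain ⟨a, b, ha, hab, hb, hn, hS⟩ := exists_Icc_subset_of_mem_nhdsWithin ht
    (inter_mem (chartAt_source_mem_nhdsWithin (n := n) hx ht)
      (chartAt_source_mem_nhdsWithin (n := n) hx' ht))
  exact ⟨a, b, ha, hab, hb, hn, fun t ht => (hS ht).1, fun t ht => (hS ht).2⟩

section Main

variable {n : ℕ} {M : Type*} [TopologicalSpace M] [ChartedSpace (RSpace n) M]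
  [IsManifold (𝓡 n) ∞ M] [RiemannianBundle (fun z : M => TangentSpace (𝓡 n) z)]
  {M' : Type*} [TopologicalSpace M'] [ChartedSpace (RSpace n) M']
  [IsManifold (𝓡 n) ∞ M'] [RiemannianBundle (fun z : M' => TangentSpace (𝓡 n) z)]
  {o : ManifoldOrientation n M} {o' : ManifoldOrientation n M'} {τ : ℝ} {x : ℝ → M} {x' : ℝ → M'}

/-- In charts, `q Z` is the matrix of `q` applied to the coordinates of `Z`. -/
theorem IsRolling.absolutelyContinuous_apply {q : ∀ t, TSpace n (x t) ≃ₗᵢ[ℝ] TSpace n (x' t)}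
    (hq : IsRolling o o' τ x x' q) {Z : ∀ t, TSpace n (x t)} (hZ : ACField τ x Z)
    {p : M} {p' : M'} {a b : ℝ} (ha : 0 ≤ a) (hab : a ≤ b) (hb : b ≤ τ)
    (hp : MapsTo x (Icc a b) (chartAt (RSpace n) p).source)
    (hp' : MapsTo x' (Icc a b) (chartAt (RSpace n) p').source) :
    AbsolutelyContinuousOnInterval (fun t => toCoord n p' (x' t) (q t (Z t))) a b := by
  refine (AbsolutelyContinuousOnInterval.clm_apply (hq.ac p p' a b ha hab hb hp hp')
    (hZ p a b ha hab hb hp)).congr fun t ht => ?_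
  rw [uIcc_of_le hab] at ht
  change toCoord n p' (x' t) (q t (ofCoord n p (x t) (toCoord n p (x t) (Z t)))) = _
  rw [ofCoord_toCoord (hp ht)]

theorem IsRolling.ae_fieldDifferentiableAt {q : ∀ t, TSpace n (x t) ≃ₗᵢ[ℝ] TSpace n (x' t)}
    (hq : IsRolling o o' τ x x' q) {Z : ∀ t, TSpace n (x t)} (hZ : ACField τ x Z) :
    ∀ᵐ t ∂(volume : Measure ℝ), t ∈ Ioo 0 τ →
      FieldDifferentiableAt x' (fun s => q s (Z s)) t := by
  refine ae_Ioo_of_locally fun t₀ ht₀ => ?_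
  obtain ⟨a, b, ha, hab, hb, hn, hp, hp'⟩ :=
    exists_Icc_mapsTo_charts (n := n) hq.ac_fst.continuousOn hq.ac_snd.continuousOn ht₀
  exact ⟨a, b, hn, ae_fieldDifferentiableAt_of_chart hab
    (hq.ac_snd.continuousOn.mono (Icc_subset_Icc ha hb)) hp'
    (hq.ac_snd.inChart _ a b ha hab hb hp') (hq.absolutelyContinuous_apply hZ ha hab hb hp hp')⟩

variable
  [IsContMDiffRiemannianBundle (𝓡 n) ∞ (EuclideanSpace ℝ (Fin n))
      (fun z : M' => TangentSpace (𝓡 n) z)]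

/-- In parallel frames a rolling has a constant matrix. -/
theorem IsRolling.apply_frame {q : ∀ t, TSpace n (x t) ≃ₗᵢ[ℝ] TSpace n (x' t)}
    (hq : IsRolling o o' τ x x' q)
    {f : ∀ t, RSpace n ≃ₗᵢ[ℝ] TSpace n (x t)} {f' : ∀ t, RSpace n ≃ₗᵢ[ℝ] TSpace n (x' t)}
    (hf : IsHorizontal o τ x f) (hf' : IsHorizontal o' τ x' f') :
    ∀ t ∈ Icc 0 τ, ∀ v, q t (f t v) = f' t ((((f 0).trans (q 0)).trans (f' 0).symm) v) := by
  let B : ℝ → RSpace n ≃ₗᵢ[ℝ] RSpace n := fun t => ((f t).trans (q t)).trans (f' t).symm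
  have hB : ∀ i j, ∀ t, inner ℝ (q t (f t (EuclideanSpace.single i 1)))
      (f' t (EuclideanSpace.single j 1)) = B t (EuclideanSpace.single i 1) j := by
    intro i j t
    have h : q t (f t (EuclideanSpace.single i 1)) = f' t (B t (EuclideanSpace.single i 1)) :=
      ((f' t).apply_symm_apply _).symm
    rw [h, (f' t).inner_map_map, EuclideanSpace.inner_single_right]
    simp
  have hconst : ∀ i j, ∀ t ∈ Icc 0 τ, B t (EuclideanSpace.single i 1) j =
      B 0 (EuclideanSpace.single i 1) j := by
    intro i j t ht
    rw [← hB, ← hB]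
    refine eq_of_locally_absolutelyContinuous (τ := τ) (F := fun t =>
      inner ℝ (q t (f t (EuclideanSpace.single i 1))) (f' t (EuclideanSpace.single j 1)))
      (fun t₀ ht₀ => ?_) ?_ t ht
    · obtain ⟨a, b, ha, hab, hb, hn, hp, hp'⟩ :=
        exists_Icc_mapsTo_charts (n := n) hq.ac_fst.continuousOn hq.ac_snd.continuousOn ht₀
      exact ⟨a, b, ha, hab, hb, hn, absolutelyContinuous_inner hab hp'
        (hq.ac_snd.inChart _ a b ha hab hb hp')
        (hq.absolutelyContinuous_apply (hf.parallel i).ac ha hab hb hp hp')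
        ((hf'.parallel j).ac _ a b ha hab hb hp')⟩
    · filter_upwards [hq.ae_fieldDifferentiableAt (hf.parallel i).ac,
        (hf'.parallel j).ac.ae_fieldDifferentiableAt hq.ac_snd,
        (hf.parallel i).covDeriv_eq_zero, (hf'.parallel j).covDeriv_eq_zero,
        hq.no_twist _ (hf.parallel i).ac] with t h1 h2 h3 h4 h5 hm
      have h := hasDerivAt_inner (h1 hm) (h2 hm)
      -- Both terms of the product rule vanish: `f'_j` is parallel, and so is `q f_i`, since no
      -- twist gives `D(q f_i)/dt = q (D f_i/dt) = 0`.
      rw [← h5 hm, h3 hm, h4 hm, map_zero, inner_zero_left, inner_zero_right, add_zero] at h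
      exact h
  intro t ht v
  have hBv : B t v = B 0 v := by
    rw [frame_apply_eq_sum (B t), frame_apply_eq_sum (B 0)]
    refine Finset.sum_congr rfl fun i _ => ?_
    congr 1
    ext j
    exact hconst i j t ht
  change _ = f' t (B 0 v)
  rw [← hBv]
  exact ((f' t).apply_symm_apply _).symm

variable
  [IsContMDiffRiemannianBundle (𝓡 n) ∞ (EuclideanSpace ℝ (Fin n))
      (fun z : M => TangentSpace (𝓡 n) z)]

/-- A constant orientation preserving isometry between parallel frames defines a rolling along
curves whose velocities it intertwines. -/
theorem isRolling_of_frames (hx : ACCurve n τ x) (hx' : ACCurve n τ x')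
    {f : ∀ t, RSpace n ≃ₗᵢ[ℝ] TSpace n (x t)} {f' : ∀ t, RSpace n ≃ₗᵢ[ℝ] TSpace n (x' t)}
    (hf : IsHorizontal o τ x f) (hf' : IsHorizontal o' τ x' f')
    (A : RSpace n ≃ₗᵢ[ℝ] RSpace n)
    (hA : Orientation.map (Fin n) A.toLinearEquiv (stdOrientation n) = stdOrientation n)
    (hd : ∀ᵐ t ∂(volume : Measure ℝ), t ∈ Ioo 0 τ →
      velocity n x' t = f' t (A ((f t).symm (velocity n x t)))) :
    IsRolling o o' τ x x' (fun t => (f t).symm.trans (A.trans (f' t))) where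
  oriented t ht := by
    have h1 := orientation_map_symm_apply (f t).toLinearEquiv (hf.oriented t ht)
    have h2 := hf'.oriented t ht
    change Orientation.map (Fin n)
      ((f t).toLinearEquiv.symm.trans (A.toLinearEquiv.trans (f' t).toLinearEquiv)) _ = _
    rw [orientation_map_trans_apply, orientation_map_trans_apply, h1, hA, h2]
  ac_fst := hx
  ac_snd := hx'
  ac p p' a b ha hab hb hp hp' := by
    refine AbsolutelyContinuousOnInterval.clm_of_apply fun i => ?_
    -- The coordinate field `∂ᵢ` in the frame `f`: its components are the inner products `⟨f_k,
    -- ∂ᵢ⟩`.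
    have h1 : AbsolutelyContinuousOnInterval
        (fun t => (f t).symm (ofCoord n p (x t) (EuclideanSpace.single i 1))) a b := by
      refine AbsolutelyContinuousOnInterval.euclidean_of_apply fun k => ?_
      have h := absolutelyContinuous_inner hab
        (Z := fun t => f t (EuclideanSpace.single k 1))
        (W := fun t => ofCoord n p (x t) (EuclideanSpace.single i 1)) hp
        (hx.inChart _ a b ha hab hb hp) ((hf.parallel k).ac p a b ha hab hb hp)
        ((AbsolutelyContinuousOnInterval.of_const (EuclideanSpace.single i (1 : ℝ))).congr
          fun t ht => (toCoord_ofCoord (hp (by rwa [uIcc_of_le hab] at ht)) _).symm)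
      refine h.congr fun t _ => ?_
      have h2 := (f t).inner_map_map (EuclideanSpace.single k 1)
        ((f t).symm (ofCoord n p (x t) (EuclideanSpace.single i 1)))
      rw [(f t).apply_symm_apply] at h2
      simp [h2, EuclideanSpace.inner_single_left]
    have h2 := AbsolutelyContinuousOnInterval.clm_comp
      (A.toContinuousLinearEquiv : RSpace n →L[ℝ] RSpace n) h1
    refine (AbsolutelyContinuousOnInterval.finsetSum Finset.univ fun k _ =>
      (h2.euclidean_apply k).fun_smul ((hf'.parallel k).ac p' a b ha hab hb hp')).congr
      fun t _ => ?_
    simp only [← map_smul, ← map_sum]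
    rw [← euclidean_eq_sum]
    rfl
  no_slip := hd
  no_twist Z hZ := by
    filter_upwards [hZ.ae_fieldDifferentiableAt hx, hx'.ae_mdifferentiableAt,
      ae_all_iff.2 fun j => (hf.parallel j).ac.ae_fieldDifferentiableAt hx,
      ae_all_iff.2 fun j => (hf'.parallel j).ac.ae_fieldDifferentiableAt hx',
      ae_all_iff.2 fun j => (hf.parallel j).covDeriv_eq_zero,
      ae_all_iff.2 fun j => (hf'.parallel j).covDeriv_eq_zero] with t h1 hdx' h2 h3 h4 h5 hm
    -- Put `c = f⁻¹ Z`. Then `Z = f c` and `q Z = f' (A c)`, so the two covariant derivatives are `f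
    -- c'` and `f' (A c')`, and `q` sends the first to the second.
    have hc := FieldDifferentiableAt.frame_symm_apply (fun j => h2 j hm) (h1 hm)
    have e1 := covDeriv_frame_apply (h1 hm).curve (fun j => h2 j hm) (fun j => h4 j hm) hc
    simp only [(f _).apply_symm_apply] at e1
    have hAc := (A.toContinuousLinearEquiv :
      RSpace n →L[ℝ] RSpace n).hasFDerivAt.comp_hasDerivAt t hc.hasDerivAt
    have e2 := covDeriv_frame_apply (hdx' hm) (fun j => h3 j hm) (fun j => h5 j hm)
      hAc.differentiableAt
    rw [hAc.deriv] at e2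
    refine Eq.trans ?_ e2.symm
    change f' t (A ((f t).symm (covDeriv x Z t))) = _
    rw [e1, (f t).symm_apply_apply]
    rfl

end Main

end Rolling

/-! ### The equivalence -/

theorem proposition2p4 (n : ℕ)
    {M : Type*} [TopologicalSpace M] [T2Space M] [SecondCountableTopology M] [ConnectedSpace M]
    [ChartedSpace (EuclideanSpace ℝ (Fin n)) M] [IsManifold (𝓡 n) ∞ M]
    [RiemannianBundle (fun z : M => TangentSpace (𝓡 n) z)]
    [IsContMDiffRiemannianBundle (𝓡 n) ∞ (EuclideanSpace ℝ (Fin n))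
      (fun z : M => TangentSpace (𝓡 n) z)]
    {M' : Type*} [TopologicalSpace M'] [T2Space M'] [SecondCountableTopology M'] [ConnectedSpace M']
    [ChartedSpace (EuclideanSpace ℝ (Fin n)) M'] [IsManifold (𝓡 n) ∞ M']
    [RiemannianBundle (fun z : M' => TangentSpace (𝓡 n) z)]
    [IsContMDiffRiemannianBundle (𝓡 n) ∞ (EuclideanSpace ℝ (Fin n))
      (fun z : M' => TangentSpace (𝓡 n) z)]
    (o : Rolling.ManifoldOrientation n M) (o' : Rolling.ManifoldOrientation n M')
    (τ : ℝ) (hτ : 0 < τ) (x : ℝ → M) (x' : ℝ → M')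
    (hx : Rolling.ACCurve n τ x) (hx' : Rolling.ACCurve n τ x')
    (y y' : ℝ → EuclideanSpace ℝ (Fin n))
    (hy : Rolling.IsAntiDevelopment o τ x y) (hy' : Rolling.IsAntiDevelopment o' τ x' y') :
    (∃ q : ∀ t, TangentSpace (𝓡 n) (x t) ≃ₗᵢ[ℝ] TangentSpace (𝓡 n) (x' t),
        Rolling.IsRolling o o' τ x x' q) ↔
      (∃ q : ∀ t, TangentSpace (𝓡 n) (y t) ≃ₗᵢ[ℝ] TangentSpace (𝓡 n) (y' t),
        Rolling.IsRolling (Rolling.euclideanOrientation n) (Rolling.euclideanOrientation n)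
          τ y y' q) := by
  obtain ⟨f, hf, hfy⟩ := hy.exists_frame
  obtain ⟨f', hf', hfy'⟩ := hy'.exists_frame
  constructor
  · rintro ⟨q, hq⟩
    have h0 : (0 : ℝ) ∈ Icc 0 τ := ⟨le_rfl, hτ.le⟩
    -- The constant isometry is the matrix of `q 0` in the frames `f 0` and `f' 0`.
    refine ⟨_, Rolling.isRolling_tangentIsometry hτ.le hy.ac hy'.ac
      (((f 0).trans (q 0)).trans (f' 0).symm) ?_ ?_⟩
    · change Orientation.map (Fin n) (((f 0).toLinearEquiv.trans (q 0).toLinearEquiv).trans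
        (f' 0).toLinearEquiv.symm) _ = _
      rw [Rolling.orientation_map_trans_apply, Rolling.orientation_map_trans_apply,
        hf.oriented 0 h0, hq.oriented 0 h0]
      exact Rolling.orientation_map_symm_apply _ (hf'.oriented 0 h0)
    · filter_upwards [hfy, hfy', hq.no_slip] with t h1 h2 h3 hm
      -- After applying `f' t`, the claim reads `q (f (deriv y t)) = f' (A (deriv y t))`, by no slip
      -- and the two anti-development equations.
      apply (f' t).injective
      rw [h2 hm, h3 hm, ← h1 hm]
      exact hq.apply_frame hf hf' t (Ioo_subset_Icc_self hm) _
  · rintro ⟨q, hq⟩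
    -- The Euclidean rolling is constant in time, so its value at `0` serves as `A`.
    refine ⟨_, Rolling.isRolling_of_frames hx hx' hf hf' (Rolling.ofTangentIsometry (q 0))
      (hq.oriented 0 ⟨le_rfl, hτ.le⟩) ?_⟩
    filter_upwards [hfy, hfy', hq.no_slip] with t h1 h2 h3 hm
    rw [← h1 hm, ← h2 hm, (f t).symm_apply_apply]
    congr 1
    have h := h3 hm
    rw [Rolling.velocity_euclidean, Rolling.velocity_euclidean] at h
    exact h.trans (hq.eq_ofTangentIsometry hτ.le t (Ioo_subset_Icc_self hm) _)
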